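/- Let $W$ denote the principal branch of the Lambert $W$ function, i.e. the holomorphic function on $\mathbb{C}\setminus(-\infty,-1/e]$ that satisfies $W(z)e^{W(z)}=z$ and maps the positive real axis onto itself (on the cut $(-\infty,-1/e]$ it is extended by its limits from the upper half-plane). Then for every $z\in\mathbb{C}\setminus\{0\}$ with $|\arg z|<\pi$ (principal argument), the following two integrals converge absolutely and $$\frac{1}{1+W(z)}=\frac{1}{\pi}\int_0^\pi\frac{dv}{1+z\,e^{v\cot v}\,\frac{\sin v}{v}},$$ $$\frac{1}{W(z)}=\frac{1}{z}+\frac{1}{\pi}\int_0^\pi\frac{v^2+(1-v\cot v)^2}{v\csc v\,\bigl(v\csc v+z\,e^{v\cot v}\bigr)}\,dv.$$ -/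

import Mathlib

/-- The branch cut `(-∞, -1/e]` of the principal branch of the Lambert function. -/
def lambertCut : Set ℂ := Complex.ofReal '' Set.Iic (-(1 / Real.exp 1))

/-- `W` is a principal branch of the inverse of `w ↦ w * exp w` off the branch cut: it is
holomorphic on `ℂ \ (-∞, -1/e]`, solves `W z * exp (W z) = z` there, and maps the positive real
axis onto itself. -/
structure IsPrincipalLambert (W : ℂ → ℂ) : Prop where
  differentiableOn : DifferentiableOn ℂ W lambertCutᶜ
  mul_exp : ∀ z ∈ lambertCutᶜ, W z * Complex.exp (W z) = z
  image_pos : W '' (Complex.ofReal '' Set.Ioi 0) = Complex.ofReal '' Set.Ioi 0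

theorem lambertCut_isClosed : IsClosed lambertCut :=
  (Complex.isometry_ofReal.isClosedEmbedding.isClosedMap) _ isClosed_Iic

theorem lambertCut_compl_isPreconnected : IsPreconnected lambertCutᶜ := by
  have h0 : (0 : ℂ) ∈ lambertCutᶜ := by
    rintro ⟨t, ht, h⟩
    have ht0 : t = 0 := by exact_mod_cast h
    have : (0 : ℝ) < 1 / Real.exp 1 := by positivity
    simp only [Set.mem_Iic] at ht
    linarith
  have hs : StarConvex ℝ (0 : ℂ) lambertCutᶜ := by
    rw [starConvex_zero_iff]
    rintro z hz a ha0 ha1 ⟨t, ht, h⟩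
    have hE : (0 : ℝ) < 1 / Real.exp 1 := by positivity
    simp only [Set.mem_Iic] at ht
    rcases ha0.eq_or_lt with rfl | ha
    · have : t = 0 := by simpa using h
      linarith
    · refine hz ⟨t / a, ?_, ?_⟩
      · simp only [Set.mem_Iic]
        rw [div_le_iff₀ ha]
        nlinarith
      · have : (a : ℂ) ≠ 0 := by exact_mod_cast ha.ne'
        simp only [Complex.real_smul] at h
        push_cast
        rw [h]
        field_simp
  exact (hs.isPathConnected h0).isConnected.isPreconnected

theorem ofReal_notMem_lambertCut {x : ℝ} (hx : 0 < x) : (x : ℂ) ∈ lambertCutᶜ := by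
  rintro ⟨t, ht, h⟩
  have htx : t = x := by exact_mod_cast h
  have : (0 : ℝ) < 1 / Real.exp 1 := by positivity
  simp only [Set.mem_Iic] at ht
  linarith

/-- The defining properties determine the principal branch off its cut. -/
theorem IsPrincipalLambert.eqOn {W₁ W₂ : ℂ → ℂ} (h₁ : IsPrincipalLambert W₁)
    (h₂ : IsPrincipalLambert W₂) : Set.EqOn W₁ W₂ lambertCutᶜ := by
  have hpos : ∀ x : ℝ, 0 < x → W₁ x = W₂ x := by
    intro x hx
    have key : ∀ W : ℂ → ℂ, IsPrincipalLambert W →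
        ∃ y : ℝ, 0 < y ∧ W x = y ∧ y * Real.exp y = x := by
      intro W h
      have hm : W x ∈ Complex.ofReal '' Set.Ioi 0 := by
        rw [← h.image_pos]
        exact ⟨x, ⟨x, hx, rfl⟩, rfl⟩
      obtain ⟨y, hy, hyx⟩ := hm
      refine ⟨y, hy, hyx.symm, ?_⟩
      have := h.mul_exp x (ofReal_notMem_lambertCut hx)
      rw [← hyx] at this
      exact_mod_cast this
    obtain ⟨y, hy, hWy, ey⟩ := key W₁ h₁
    obtain ⟨y', hy', hWy', ey'⟩ := key W₂ h₂
    rw [hWy, hWy']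
    rcases lt_trichotomy y y' with hlt | heq | hlt
    · have := mul_lt_mul'' hlt (Real.exp_lt_exp.2 hlt) hy.le (Real.exp_pos y).le
      linarith
    · rw [heq]
    · have := mul_lt_mul'' hlt (Real.exp_lt_exp.2 hlt) hy'.le (Real.exp_pos y').le
      linarith
  have ho : IsOpen lambertCutᶜ := lambertCut_isClosed.isOpen_compl
  refine (h₁.differentiableOn.analyticOnNhd ho).eqOn_of_preconnected_of_frequently_eq
    (h₂.differentiableOn.analyticOnNhd ho) lambertCut_compl_isPreconnected
    (ofReal_notMem_lambertCut one_pos) ?_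
  have ht : Filter.Tendsto (fun t : ℝ => (t : ℂ)) (nhdsWithin 1 (Set.Ioi 1))
      (nhdsWithin ((1 : ℝ) : ℂ) {((1 : ℝ) : ℂ)}ᶜ) := by
    refine tendsto_nhdsWithin_iff.2 ⟨?_, ?_⟩
    · exact (Complex.continuous_ofReal.tendsto 1).mono_left nhdsWithin_le_nhds
    · filter_upwards [self_mem_nhdsWithin] with t ht h
      have h' : t = 1 := by
        rw [Set.mem_singleton_iff] at h
        exact_mod_cast h
      exact (ne_of_gt ht) h'
  refine ht.frequently (Filter.Eventually.frequently ?_)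
  filter_upwards [self_mem_nhdsWithin] with t ht
  exact hpos t (lt_trans one_pos ht)

/-- The principal branch of the Lambert function off the cut, as the function (unique there by
`IsPrincipalLambert.eqOn`) with the properties in `IsPrincipalLambert`. -/
noncomputable def lambertWOffCut : ℂ → ℂ := Classical.epsilon IsPrincipalLambert

open Classical in
/-- The principal branch `W` of the Lambert function on `ℂ`. On the branch cut its values are the
limits from the upper half-plane. -/
noncomputable def lambertW (z : ℂ) : ℂ :=
  if z ∈ lambertCut then Filter.limUnder (nhdsWithin z {w : ℂ | 0 < w.im}) lambertWOffCut
  else lambertWOffCut z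

/-- The cosecant of a real number. -/
noncomputable def csc (v : ℝ) : ℝ := 1 / Real.sin v

open Complex Filter Topology Set

/-! Let `q` be `lambertDensity` and `S_R` be `lambertStieltjes R`. On the curve `γ v = -v cot v + i
v` one has `γ exp γ = -1 / q`. Since `Im γ' = 1`, `∫ (-q)^n` is the variation along `γ` of the
imaginary part of a primitive of `exp (-n w) / w^n`, which gives the moments `n^n / n!` of `q / π`
(`integral_lambertDensity_pow`).

By these moments `S_1` has the Taylor series `∑ (-z)^n n^n / n!`, and this sums to `1 / (1 + w)` at
`z = w exp w` for small `w ≥ 0` (`hasSum_one_div_one_add`). Moreover `S_1` is holomorphic and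
zero-free off the cut, so the identity theorem shows that `1 / S_1 - 1` is a principal branch, and
uniqueness makes it `W`. This is the first formula.

For the second, `(exp W)' = 1 / (1 + W) = S_1`, and an integration by parts in `v` gives `(1 + z
S_R)' = S_1` for `R = lambertWeight`. Both functions are `1` at `0`, so `exp W = 1 + z S_R`; divide
by `z = W exp W`. -/

/-! ### Primitives of `exp (-a w) / w ^ n` -/

/-- The imaginary part of a differentiable curve has the imaginary part of the derivative as its
derivative. -/
theorem HasDerivAt.complex_im {f : ℝ → ℂ} {f' : ℂ} {x : ℝ} (h : HasDerivAt f f' x) :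
    HasDerivAt (fun t => (f t).im) f'.im x :=
  Complex.imCLM.hasFDerivAt.comp_hasDerivAt x h

/-- The entire function `(exp (-a w) - 1) / w` has a primitive that is real on the real axis. -/
theorem exists_real_primitive_exp_sub_one_div (a : ℝ) :
    ∃ g : ℂ → ℂ, Differentiable ℂ g ∧
      (∀ w, w ≠ 0 → HasDerivAt g ((exp (-a * w) - 1) / w) w) ∧ ∀ x : ℝ, (g x).im = 0 := by
  set f : ℂ → ℂ := fun w => exp (-a * w) with hf
  have hfd : ∀ w, HasDerivAt f (exp (-a * w) * (-a)) w := fun w => by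
    simpa [hf] using ((hasDerivAt_id w).const_mul (-a : ℂ)).cexp
  -- `dslope` fills the removable singularity at `0`.
  have hd : Differentiable ℂ (dslope f 0) := by
    rw [← differentiableOn_univ, Complex.differentiableOn_dslope univ_mem]
    exact fun w _ => (hfd w).differentiableAt.differentiableWithinAt
  obtain ⟨g, hg0, hg⟩ := hd.isExactOn_univ.with_val_at 0 0
  have hval : ∀ w, w ≠ 0 → dslope f 0 w = (exp (-a * w) - 1) / w := fun w hw => by
    rw [dslope_of_ne _ hw, slope_def_field]
    simp [hf]
  refine ⟨g, fun w => (hg w trivial).differentiableAt, fun w hw => ?_, ?_⟩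
  · rw [← hval w hw]
    exact hg w trivial
  · have him : ∀ x : ℝ, (dslope f 0 x).im = 0 := fun x => by
      by_cases hx : (x : ℂ) = 0
      · rw [hx, dslope_same, (hfd 0).deriv]
        simp
      · rw [hval _ hx]
        have : (exp (-a * x) - 1) / (x : ℂ) = (((Real.exp (-a * x) - 1) / x : ℝ) : ℂ) := by
          push_cast
          rfl
        rw [this, ofReal_im]
    have hder : ∀ x : ℝ, HasDerivAt (fun t : ℝ => (g t).im) 0 x := fun x => by
      have := (hg (x : ℂ) trivial).comp_ofReal.complex_im
      rwa [him] at this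
    intro x
    have := is_const_of_deriv_eq_zero (fun t => (hder t).differentiableAt)
      (fun t => (hder t).deriv) x 0
    simpa [hg0] using this

/-- Primitives of `exp (-a w) / w ^ (m + 1)` on the slit plane that are real on the positive axis;
the limit of the imaginary part at `-1` is half of the residue at `0`, times `2 π`. -/
theorem exists_primitive_exp_div_pow (a : ℝ) (m : ℕ) :
    ∃ H : ℂ → ℂ, (∀ w ∈ slitPlane, HasDerivAt H (exp (-a * w) / w ^ (m + 1)) w) ∧
      (∀ x : ℝ, 0 < x → (H x).im = 0) ∧
      Tendsto (fun w => (H w).im) (𝓝[{w : ℂ | 0 ≤ w.im}] (-1))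
        (𝓝 (Real.pi * ((-a) ^ m / m.factorial))) := by
  induction m with
  | zero =>
    obtain ⟨g, hg, hg', hgr⟩ := exists_real_primitive_exp_sub_one_div a
    refine ⟨fun w => log w + g w, fun w hw => ?_, fun x hx => ?_, ?_⟩
    · have hw0 := slitPlane_ne_zero hw
      refine ((hasDerivAt_log hw).add (hg' w hw0)).congr_deriv ?_
      field_simp
      ring
    · beta_reduce
      rw [← ofReal_log hx.le]
      simp [hgr]
    -- All of the limit comes from `log`, whose argument tends to `π`; `g` is real at `-1`.
    · have h1 := tendsto_log_nhdsWithin_im_nonneg_of_re_neg_of_im_zero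
        (z := -1) (by simp) (by simp)
      have h2 : Tendsto g (𝓝[{w : ℂ | 0 ≤ w.im}] (-1)) (𝓝 (g (-1))) :=
        (hg.continuous.tendsto _).mono_left nhdsWithin_le_nhds
      have h3 := (continuous_im.tendsto _).comp (h1.add h2)
      have h4 : (g (-1)).im = 0 := by simpa using hgr (-1)
      simpa [Function.comp_def, h4] using h3
  | succ m ih =>
    obtain ⟨H, hH, hr, ht⟩ := ih
    -- Integration by parts lowers the order of the pole. The boundary term is real at `-1`, so the
    -- limit is only multiplied by `-a / (m + 1)`.
    refine ⟨fun w => (((-1 / (m + 1) : ℝ)) : ℂ) *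
      (exp (-a * w) / w ^ (m + 1) + (a : ℂ) * H w), fun w hw => ?_, fun x hx => ?_, ?_⟩
    · have hw0 := slitPlane_ne_zero hw
      have hm : (m : ℂ) + 1 ≠ 0 := by exact_mod_cast Nat.succ_ne_zero m
      have he : HasDerivAt (fun w : ℂ => exp (-a * w)) (exp (-a * w) * (-a)) w := by
        simpa using ((hasDerivAt_id w).const_mul (-a : ℂ)).cexp
      refine (((he.div (hasDerivAt_pow (m + 1) w) (pow_ne_zero _ hw0)).add
        ((hH w hw).const_mul (a : ℂ))).const_mul (((-1 / (m + 1) : ℝ)) : ℂ)).congr_deriv ?_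
      push_cast
      field_simp
      ring
    · have : exp (-a * x) / (x : ℂ) ^ (m + 1) = ((Real.exp (-a * x) / x ^ (m + 1) : ℝ) : ℂ) := by
        push_cast
        rfl
      beta_reduce
      rw [this, im_ofReal_mul, add_im, im_ofReal_mul, hr x hx, ofReal_im]
      simp
    · have hc : Tendsto (fun w : ℂ => (exp (-a * w) / w ^ (m + 1)).im)
          (𝓝[{w : ℂ | 0 ≤ w.im}] (-1)) (𝓝 0) := by
        have hca : ContinuousAt (fun w : ℂ => (exp (-a * w) / w ^ (m + 1)).im) (-1) := by
          refine continuous_im.continuousAt.comp (ContinuousAt.div (by fun_prop) (by fun_prop) ?_)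
          exact pow_ne_zero _ (by norm_num)
        have h0 : (exp (-a * (-1)) / (-1 : ℂ) ^ (m + 1)).im = 0 := by
          have : exp (-a * (-1)) / (-1 : ℂ) ^ (m + 1)
              = ((Real.exp (-a * (-1)) / (-1) ^ (m + 1) : ℝ) : ℂ) := by
            push_cast
            rfl
          rw [this, ofReal_im]
        rw [← h0]
        exact hca.tendsto.mono_left nhdsWithin_le_nhds
      have := (hc.add (ht.const_mul a)).const_mul (-1 / ((m : ℝ) + 1))
      convert this using 2
      · rw [im_ofReal_mul, add_im, im_ofReal_mul]
      · rw [Nat.factorial_succ]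
        have : (m : ℝ) + 1 ≠ 0 := by positivity
        have := Nat.factorial_ne_zero m
        push_cast
        field_simp
        ring

/-! ### The density and the boundary curve -/

/-- The density `q` with `1 / q = - γ exp γ` along the boundary curve `γ` of the range of the
principal branch. -/
noncomputable def lambertDensity (v : ℝ) : ℝ := Real.exp (v * Real.cot v) * Real.sin v / v

/-- The boundary curve of the range of the principal branch. -/
noncomputable def lambertCurve (v : ℝ) : ℂ := ((-(v * Real.cot v) : ℝ) : ℂ) + v * I

theorem lambertDensity_pos {v : ℝ} (hv : v ∈ Ioo 0 Real.pi) : 0 < lambertDensity v := by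
  have := Real.sin_pos_of_mem_Ioo hv
  have := hv.1
  unfold lambertDensity
  positivity

theorem mul_cot_le_one {v : ℝ} (hv : v ∈ Ioo 0 Real.pi) : v * Real.cot v ≤ 1 := by
  have hs := Real.sin_pos_of_mem_Ioo hv
  rw [Real.cot_eq_cos_div_sin, ← mul_div_assoc, div_le_one hs]
  rcases lt_or_ge v (Real.pi / 2) with h | h
  · have hc : 0 < Real.cos v := Real.cos_pos_of_mem_Ioo ⟨by linarith [hv.1, Real.pi_pos], h⟩
    have := Real.lt_tan hv.1 h
    rw [Real.tan_eq_sin_div_cos, lt_div_iff₀ hc] at this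
    exact this.le
  · have : Real.cos v ≤ 0 := Real.cos_nonpos_of_pi_div_two_le_of_le h (by linarith [hv.2])
    nlinarith [hv.1]

theorem lambertDensity_le {v : ℝ} (hv : v ∈ Ioo 0 Real.pi) : lambertDensity v ≤ Real.exp 1 := by
  unfold lambertDensity
  rw [div_le_iff₀ hv.1]
  exact mul_le_mul (Real.exp_le_exp.2 (mul_cot_le_one hv)) (Real.sin_le hv.1.le)
    (Real.sin_pos_of_mem_Ioo hv).le (Real.exp_pos 1).le

theorem measurable_lambertDensity : Measurable lambertDensity := by
  unfold lambertDensity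
  simp only [Real.cot_eq_cos_div_sin]
  fun_prop

theorem hasDerivAt_mul_cot {v : ℝ} (hs : Real.sin v ≠ 0) :
    HasDerivAt (fun v => v * Real.cot v) (Real.cot v - v / Real.sin v ^ 2) v := by
  have h : (fun v => v * Real.cot v) = fun v => v * (Real.cos v / Real.sin v) := by
    ext v
    rw [Real.cot_eq_cos_div_sin]
  rw [h, Real.cot_eq_cos_div_sin]
  refine ((hasDerivAt_id' v).mul
    ((Real.hasDerivAt_cos v).div (Real.hasDerivAt_sin v) hs)).congr_deriv ?_
  simp only [Pi.div_apply]
  field_simp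
  linear_combination (-v) * Real.sin_sq_add_cos_sq v

theorem hasDerivAt_lambertDensity {v : ℝ} (hv : v ∈ Ioo 0 Real.pi) :
    HasDerivAt lambertDensity
      (lambertDensity v * (2 * Real.cot v - v / Real.sin v ^ 2 - 1 / v)) v := by
  have hs := (Real.sin_pos_of_mem_Ioo hv).ne'
  have hv0 := hv.1.ne'
  unfold lambertDensity
  refine (((hasDerivAt_mul_cot hs).exp.mul (Real.hasDerivAt_sin v)).div
    (hasDerivAt_id' v) hv0).congr_deriv ?_
  simp only [Pi.mul_apply, Real.cot_eq_cos_div_sin]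
  field_simp
  ring

/-- The polar form of `γ`: its phase `exp (-i v)` cancels that of `exp γ`, which makes `γ exp γ`
real. -/
theorem lambertCurve_mul_sin {v : ℝ} (hs : Real.sin v ≠ 0) :
    lambertCurve v * Real.sin v = - (v * exp (-(v * I))) := by
  have h : exp (-(v * I)) = Real.cos v - Real.sin v * I := by
    rw [← neg_mul, ← ofReal_neg, exp_mul_I, ← ofReal_cos, ← ofReal_sin, Real.cos_neg, Real.sin_neg]
    push_cast
    ring
  have hs' : (Real.sin v : ℂ) ≠ 0 := by exact_mod_cast hs
  rw [h, lambertCurve, Real.cot_eq_cos_div_sin]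
  push_cast at hs' ⊢
  field_simp
  ring

theorem lambertDensity_mul_curve {v : ℝ} (hv : v ∈ Ioo 0 Real.pi) :
    (lambertDensity v : ℂ) * (lambertCurve v * exp (lambertCurve v)) = -1 := by
  have hs : (Real.sin v : ℂ) ≠ 0 := by exact_mod_cast (Real.sin_pos_of_mem_Ioo hv).ne'
  have hv0 : (v : ℂ) ≠ 0 := by exact_mod_cast hv.1.ne'
  have h := lambertCurve_mul_sin (Real.sin_pos_of_mem_Ioo hv).ne'
  have he : exp (lambertCurve v) = exp (-((v * Real.cot v : ℝ) : ℂ)) * exp (v * I) := by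
    rw [lambertCurve, exp_add, ofReal_neg]
  have h1 : exp ((v * Real.cot v : ℝ) : ℂ) * exp (-((v * Real.cot v : ℝ) : ℂ)) = 1 := by
    rw [← exp_add, add_neg_cancel, exp_zero]
  have h2 : exp (-(v * I)) * exp (v * I) = 1 := by
    rw [← exp_add, neg_add_cancel, exp_zero]
  have hq : (lambertDensity v : ℂ) = exp ((v * Real.cot v : ℝ) : ℂ) * Real.sin v / v := by
    rw [lambertDensity, ofReal_div, ofReal_mul, ofReal_exp]
  rw [hq, he]
  field_simp
  linear_combination (exp ((v * Real.cot v : ℝ) : ℂ) * exp (-((v * Real.cot v : ℝ) : ℂ)) *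
    exp (v * I)) * h - v * exp ((v * Real.cot v : ℝ) : ℂ) * exp (-((v * Real.cot v : ℝ) : ℂ)) * h2
    - v * h1

theorem hasDerivAt_lambertCurve {v : ℝ} (hs : Real.sin v ≠ 0) :
    HasDerivAt lambertCurve (((-(Real.cot v - v / Real.sin v ^ 2) : ℝ) : ℂ) + I) v := by
  unfold lambertCurve
  exact (hasDerivAt_mul_cot hs).neg.ofReal_comp.add (by simpa using (hasDerivAt_id v).ofReal_comp.mul_const I)

theorem lambertCurve_im (v : ℝ) : (lambertCurve v).im = v := by
  rw [lambertCurve, add_im, ofReal_im, im_ofReal_mul, I_im]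
  ring

theorem lambertCurve_re (v : ℝ) : (lambertCurve v).re = -(v * Real.cot v) := by
  rw [lambertCurve, add_re, ofReal_re, re_ofReal_mul, I_re]
  ring

/-- The point `-1` lies on the cut of `log`, so the side of approach must be recorded. -/
theorem tendsto_lambertCurve_zero :
    Tendsto lambertCurve (𝓝[>] 0) (𝓝[{w : ℂ | 0 ≤ w.im}] (-1)) := by
  rw [tendsto_nhdsWithin_iff]
  refine ⟨?_, ?_⟩
  · have h1 : Tendsto (fun v : ℝ => Real.sin v / v) (𝓝[>] 0) (𝓝 1) := by
      have := (Real.hasDerivAt_sin 0).tendsto_slope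
      simp only [Real.cos_zero] at this
      refine (this.mono_left (nhdsWithin_mono _ fun x hx => ne_of_gt hx)).congr fun v => ?_
      simp [slope_def_field]
    have h2 : Tendsto Real.cos (𝓝[>] 0) (𝓝 1) := by
      have := (Real.continuous_cos.tendsto 0).mono_left (nhdsWithin_le_nhds (s := Ioi 0))
      simpa using this
    have h3 : Tendsto (fun v : ℝ => v * Real.cot v) (𝓝[>] 0) (𝓝 1) := by
      have := h2.mul (h1.inv₀ one_ne_zero)
      simp only [inv_one, mul_one] at this
      refine this.congr fun v => ?_
      rw [Real.cot_eq_cos_div_sin, inv_div]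
      ring
    have h4 : Tendsto (fun v : ℝ => (v : ℂ) * I) (𝓝[>] 0) (𝓝 0) := by
      have hc : Continuous fun v : ℝ => (v : ℂ) * I := by fun_prop
      simpa using (hc.tendsto 0).mono_left nhdsWithin_le_nhds
    have := ((continuous_ofReal.tendsto _).comp h3.neg).add h4
    rw [add_zero, ofReal_neg, ofReal_one] at this
    exact this
  · filter_upwards [self_mem_nhdsWithin] with v hv
    simpa [lambertCurve_im] using le_of_lt hv

theorem tendsto_lambertCurve_re_pi :
    Tendsto (fun v => (lambertCurve v).re) (𝓝[<] Real.pi) atTop := by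
  have h1 : Tendsto (fun v : ℝ => (Real.sin v)⁻¹) (𝓝[<] Real.pi) atTop := by
    refine Tendsto.inv_tendsto_nhdsGT_zero (tendsto_nhdsWithin_iff.2 ⟨?_, ?_⟩)
    · simpa using (Real.continuous_sin.tendsto Real.pi).mono_left nhdsWithin_le_nhds
    · filter_upwards [Ioo_mem_nhdsLT Real.pi_pos] with v hv
      exact Real.sin_pos_of_mem_Ioo hv
  have h2 : Tendsto (fun v : ℝ => -(v * Real.cos v)) (𝓝[<] Real.pi) (𝓝 Real.pi) := by
    have hc : Continuous fun v : ℝ => -(v * Real.cos v) := by fun_prop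
    simpa using (hc.tendsto Real.pi).mono_left nhdsWithin_le_nhds
  refine (h2.pos_mul_atTop Real.pi_pos h1).congr fun v => ?_
  rw [lambertCurve_re, Real.cot_eq_cos_div_sin]
  ring

/-! ### Moments of the density -/

theorem intervalIntegrable_zero_pi_of_norm_le {E : Type*} [NormedAddCommGroup E] {f : ℝ → E}
    (hf : MeasureTheory.AEStronglyMeasurable f) {C : ℝ} (h : ∀ v ∈ Ioo 0 Real.pi, ‖f v‖ ≤ C) :
    IntervalIntegrable f MeasureTheory.volume 0 Real.pi := by
  rw [intervalIntegrable_iff_integrableOn_Ioo_of_le Real.pi_pos.le]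
  refine MeasureTheory.Measure.integrableOn_of_bounded (M := C) (by simp) hf ?_
  exact (MeasureTheory.ae_restrict_iff' measurableSet_Ioo).2 (Eventually.of_forall h)

theorem intervalIntegrable_lambertDensity_pow (n : ℕ) :
    IntervalIntegrable (fun v => lambertDensity v ^ n) MeasureTheory.volume 0 Real.pi := by
  refine intervalIntegrable_zero_pi_of_norm_le
    (measurable_lambertDensity.pow_const n).aestronglyMeasurable (C := Real.exp 1 ^ n) fun v hv => ?_
  rw [norm_pow, Real.norm_of_nonneg (lambertDensity_pos hv).le]
  exact pow_le_pow_left₀ (lambertDensity_pos hv).le (lambertDensity_le hv) n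

theorem lambertCurve_mem_slitPlane {v : ℝ} (hv : v ∈ Ioo 0 Real.pi) :
    lambertCurve v ∈ slitPlane :=
  Or.inr (by rw [lambertCurve_im]; exact hv.1.ne')

theorem exp_div_pow_lambertCurve {v : ℝ} (hv : v ∈ Ioo 0 Real.pi) (n : ℕ) :
    exp (-((n : ℝ) : ℂ) * lambertCurve v) / lambertCurve v ^ n
      = (((-lambertDensity v) ^ n : ℝ) : ℂ) := by
  have h := lambertDensity_mul_curve hv
  have hg := slitPlane_ne_zero (lambertCurve_mem_slitPlane hv)
  have he : exp (-((n : ℝ) : ℂ) * lambertCurve v) = (exp (lambertCurve v) ^ n)⁻¹ := by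
    rw [← exp_nat_mul, ← exp_neg, ofReal_natCast, neg_mul]
  have hq : ((-lambertDensity v : ℝ) : ℂ) = (lambertCurve v * exp (lambertCurve v))⁻¹ := by
    refine eq_inv_of_mul_eq_one_left ?_
    rw [ofReal_neg]
    linear_combination -h
  rw [he, ofReal_pow, hq, inv_pow, mul_pow, mul_inv, div_eq_mul_inv, mul_comm]

theorem norm_exp_div_pow_le {a : ℝ} (ha : 0 ≤ a) (n : ℕ) {x : ℝ} (hx : 1 ≤ x) {w : ℂ}
    (hw : x ≤ w.re) : ‖exp (-(a : ℂ) * w) / w ^ n‖ ≤ Real.exp (-a * x) := by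
  have h1 : 1 ≤ ‖w‖ := (hx.trans hw).trans (re_le_norm w)
  rw [norm_div, norm_pow, norm_exp, ← ofReal_neg, re_ofReal_mul]
  refine (div_le_self (Real.exp_pos _).le (one_le_pow₀ h1)).trans ?_
  exact Real.exp_le_exp.2 (by nlinarith)

/-- The moments of the density. -/
theorem integral_lambertDensity_pow (n : ℕ) :
    ∫ v in (0 : ℝ)..Real.pi, lambertDensity v ^ n = Real.pi * (n ^ n / n.factorial) := by
  rcases n with _ | m
  · simp
  -- The exponential rate equals the order of the pole, so that `H'` is a power of `1 / (w exp w)`,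
  -- hence real on the curve.
  obtain ⟨H, hH, hr, ht⟩ := exists_primitive_exp_div_pow ((m + 1 : ℕ) : ℝ) m
  have hder : ∀ v ∈ Ioo 0 Real.pi, HasDerivAt (fun v => (H (lambertCurve v)).im)
      ((-lambertDensity v) ^ (m + 1)) v := fun v hv => by
    have h1 := (hH _ (lambertCurve_mem_slitPlane hv)).comp v
      (hasDerivAt_lambertCurve (Real.sin_pos_of_mem_Ioo hv).ne')
    rw [exp_div_pow_lambertCurve hv] at h1
    have h2 := h1.complex_im
    rw [im_ofReal_mul, add_im, ofReal_im, I_im, zero_add, mul_one] at h2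
    exact h2
  -- Compare with the real value of `H` at `x = Re γ`: the vertical distance is less than `π`, and
  -- `|H'| ≤ exp (-(m + 1) x)` to the right of `x`.
  have hpi : Tendsto (fun v => (H (lambertCurve v)).im) (𝓝[<] Real.pi) (𝓝 0) := by
    have hb : ∀ᶠ v in 𝓝[<] Real.pi, ‖(H (lambertCurve v)).im‖
        ≤ Real.exp (-((m + 1 : ℕ) : ℝ) * (lambertCurve v).re) * Real.pi := by
      filter_upwards [tendsto_lambertCurve_re_pi.eventually_ge_atTop 1,
        Ioo_mem_nhdsLT Real.pi_pos] with v h1 hv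
      set x := (lambertCurve v).re
      have hmv := (convex_halfSpace_re_ge x).norm_image_sub_le_of_norm_hasDerivWithin_le
        (f := H) (f' := fun w => exp (-(((m + 1 : ℕ) : ℝ) : ℂ) * w) / w ^ (m + 1))
        (C := Real.exp (-((m + 1 : ℕ) : ℝ) * x)) (x := (x : ℂ)) (y := lambertCurve v)
        (fun w hw => (hH w (Or.inl (by
          have : x ≤ w.re := hw
          linarith))).hasDerivWithinAt)
        (fun w hw => norm_exp_div_pow_le (by positivity) _ h1 hw) (ofReal_re x).ge (le_refl x)
      have him : (H (lambertCurve v) - H x).im = (H (lambertCurve v)).im := by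
        rw [sub_im, hr x (by linarith), sub_zero]
      have hn : ‖lambertCurve v - (x : ℂ)‖ ≤ Real.pi := by
        have : lambertCurve v - (x : ℂ) = (v : ℂ) * I := by
          apply Complex.ext <;> simp [x, lambertCurve_im]
        rw [this, norm_mul, norm_I, mul_one, norm_real, Real.norm_of_nonneg hv.1.le]
        exact hv.2.le
      rw [← him]
      exact (abs_im_le_norm _).trans (hmv.trans (by gcongr))
    refine squeeze_zero_norm' hb ?_
    have h1 : Tendsto (fun v => -((m + 1 : ℕ) : ℝ) * (lambertCurve v).re) (𝓝[<] Real.pi) atBot :=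
      tendsto_lambertCurve_re_pi.const_mul_atTop_of_neg (by
        rw [neg_lt_zero]
        positivity)
    simpa using (Real.tendsto_exp_atBot.comp h1).mul_const Real.pi
  have hint : IntervalIntegrable (fun v => (-lambertDensity v) ^ (m + 1))
      MeasureTheory.volume 0 Real.pi := by
    simp_rw [neg_pow (lambertDensity _)]
    exact (intervalIntegrable_lambertDensity_pow (m + 1)).const_mul _
  have key := intervalIntegral.integral_eq_sub_of_hasDerivAt_of_tendsto Real.pi_pos hder hint
    (ht.comp tendsto_lambertCurve_zero) hpi
  simp_rw [neg_pow (lambertDensity _)] at key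
  rw [intervalIntegral.integral_const_mul] at key
  have hs : ((-1 : ℝ) ^ (m + 1)) * (-1) ^ (m + 1) = 1 := by
    rw [← mul_pow]
    norm_num
  have hm := Nat.factorial_ne_zero m
  calc _ = (-1) ^ (m + 1) * ((-1) ^ (m + 1) *
        ∫ v in (0 : ℝ)..Real.pi, lambertDensity v ^ (m + 1)) := by
        rw [← mul_assoc, hs, one_mul]
    _ = _ := by
        rw [key, neg_pow ((m + 1 : ℕ) : ℝ) m, Nat.factorial_succ]
        push_cast
        field_simp
        linear_combination (Real.pi * ((m : ℝ) + 1) ^ (m + 1)) * hs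

/-! ### Stieltjes integrals off the cut -/

/-- The Stieltjes-type integral with weight `R`. -/
noncomputable def lambertStieltjes (R : ℝ → ℝ) (z : ℂ) : ℂ :=
  (1 / (Real.pi : ℂ)) * ∫ v in (0 : ℝ)..Real.pi, (R v : ℂ) / (1 + z * lambertDensity v)

theorem lambertDensity_mem_Icc {v : ℝ} (hv : v ∈ Ioc 0 Real.pi) :
    lambertDensity v ∈ Icc 0 (Real.exp 1) := by
  rcases hv.2.eq_or_lt with h | h
  · have : lambertDensity v = 0 := by simp [lambertDensity, h]
    rw [this]
    exact ⟨le_rfl, (Real.exp_pos 1).le⟩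
  · exact ⟨(lambertDensity_pos ⟨hv.1, h⟩).le, lambertDensity_le ⟨hv.1, h⟩⟩

/-- A zero would force `z = -1 / t ≤ -1 / e`; the bound `q ≤ e` is what matches the cut. -/
theorem one_add_mul_ne_zero {z : ℂ} (hz : z ∈ lambertCutᶜ) {t : ℝ} (ht : t ∈ Icc 0 (Real.exp 1)) :
    1 + z * t ≠ 0 := by
  intro h
  have ht0 : t ≠ 0 := by
    rintro rfl
    simp at h
  have htp : 0 < t := lt_of_le_of_ne ht.1 ht0.symm
  refine hz ⟨-(1 / t), ?_, ?_⟩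
  · exact neg_le_neg (one_div_le_one_div_of_le htp ht.2)
  · have : (t : ℂ) ≠ 0 := by exact_mod_cast ht0
    push_cast
    field_simp
    linear_combination -h

/-- Compactness of a closed ball times `[0, e]`. Uniformity in `z` gives the domination needed to
differentiate under the integral. -/
theorem exists_norm_one_add_mul_ge {z₀ : ℂ} (hz : z₀ ∈ lambertCutᶜ) :
    ∃ δ > 0, ∃ c > 0, ∀ z ∈ Metric.ball z₀ δ, ∀ t ∈ Icc 0 (Real.exp 1),
      c ≤ ‖1 + z * (t : ℂ)‖ := by
  obtain ⟨δ, hδ, hsub⟩ := Metric.nhds_basis_closedBall.mem_iff.1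
    (lambertCut_isClosed.isOpen_compl.mem_nhds hz)
  have hK : IsCompact (Metric.closedBall z₀ δ ×ˢ Icc 0 (Real.exp 1)) :=
    (isCompact_closedBall z₀ δ).prod isCompact_Icc
  obtain ⟨⟨z₁, t₁⟩, hp, hmin⟩ := hK.exists_isMinOn
    ⟨(z₀, 0), Metric.mem_closedBall_self hδ.le, le_rfl, (Real.exp_pos 1).le⟩
    (f := fun p : ℂ × ℝ => ‖1 + p.1 * (p.2 : ℂ)‖) (by fun_prop)
  refine ⟨δ, hδ, ‖1 + z₁ * (t₁ : ℂ)‖, norm_pos_iff.2 (one_add_mul_ne_zero (hsub hp.1) hp.2),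
    fun z hz t ht => ?_⟩
  exact hmin (show (z, t) ∈ _ from ⟨Metric.ball_subset_closedBall hz, ht⟩)

theorem intervalIntegrable_weight_div {R : ℝ → ℝ} (hR : Measurable R) {C : ℝ}
    (hC : ∀ v, |R v| ≤ C) {z : ℂ} (hz : z ∈ lambertCutᶜ) (n : ℕ) :
    IntervalIntegrable (fun v => (R v : ℂ) / (1 + z * lambertDensity v) ^ n)
      MeasureTheory.volume 0 Real.pi := by
  obtain ⟨δ, hδ, c, hc, h⟩ := exists_norm_one_add_mul_ge hz
  have hC0 : 0 ≤ C := (abs_nonneg _).trans (hC 0)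
  have hq := measurable_lambertDensity
  refine intervalIntegrable_zero_pi_of_norm_le (C := C / c ^ n)
    (by fun_prop : Measurable _).aestronglyMeasurable fun v hv => ?_
  rw [norm_div, norm_pow, norm_real]
  have := h z (Metric.mem_ball_self hδ) _ (lambertDensity_mem_Icc ⟨hv.1, hv.2.le⟩)
  have := hC v
  rw [← Real.norm_eq_abs] at this
  gcongr

theorem hasDerivAt_lambertStieltjes {R : ℝ → ℝ} (hR : Measurable R) {C : ℝ}
    (hC : ∀ v, |R v| ≤ C) {z : ℂ} (hz : z ∈ lambertCutᶜ) :
    HasDerivAt (lambertStieltjes R) ((1 / (Real.pi : ℂ)) * ∫ v in (0 : ℝ)..Real.pi,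
      -((R v : ℂ) * lambertDensity v) / (1 + z * lambertDensity v) ^ 2) z := by
  obtain ⟨δ, hδ, c, hc, h⟩ := exists_norm_one_add_mul_ge hz
  have hC0 : 0 ≤ C := (abs_nonneg _).trans (hC 0)
  have hq := measurable_lambertDensity
  refine HasDerivAt.const_mul _ ?_
  refine (intervalIntegral.hasDerivAt_integral_of_dominated_loc_of_deriv_le
    (bound := fun _ => C * Real.exp 1 / c ^ 2)
    (F' := fun z v => -((R v : ℂ) * lambertDensity v) / (1 + z * lambertDensity v) ^ 2)
    (Metric.ball_mem_nhds z hδ)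
    (Eventually.of_forall fun z => (by fun_prop : Measurable _).aestronglyMeasurable)
    (by simpa using intervalIntegrable_weight_div hR hC hz 1)
    (by fun_prop : Measurable _).aestronglyMeasurable
    (Eventually.of_forall fun v hv w hw => ?_) intervalIntegrable_const
    (Eventually.of_forall fun v hv w hw => ?_)).2
  · rw [uIoc_of_le Real.pi_pos.le] at hv
    have hm := lambertDensity_mem_Icc hv
    have h1 := h w hw _ hm
    rw [norm_div, norm_neg, norm_mul, norm_pow, norm_real, norm_real, Real.norm_of_nonneg hm.1]
    have h2 := hC v
    have h3 := hm.2
    have h4 := hm.1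
    rw [← Real.norm_eq_abs] at h2
    gcongr
  · rw [uIoc_of_le Real.pi_pos.le] at hv
    have hm := lambertDensity_mem_Icc hv
    have h1 := h w hw _ hm
    have hne : 1 + w * (lambertDensity v : ℂ) ≠ 0 := norm_pos_iff.1 (hc.trans_le h1)
    have hd : HasDerivAt (fun w : ℂ => 1 + w * (lambertDensity v : ℂ)) (lambertDensity v : ℂ) w := by
      simpa using ((hasDerivAt_id w).mul_const (lambertDensity v : ℂ)).const_add 1
    refine ((hasDerivAt_const w (R v : ℂ)).div hd hne).congr_deriv ?_
    ring

/-! ### The power series near `0` -/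

/-- Up to the factor `(-1)^m / m!`, this is the `m`-th forward difference of `x^m` at `0`, which is
`m!`. -/
theorem sum_antidiagonal_neg_one_pow_mul_pow (m : ℕ) :
    ∑ p ∈ Finset.HasAntidiagonal.antidiagonal m,
      ((-1 : ℝ) ^ p.1 * p.1 ^ p.1 / p.1.factorial) * ((p.1 : ℝ) ^ p.2 / p.2.factorial)
        = (-1) ^ m := by
  have h := congrFun (fwdDiff_iter_eq_factorial (R := ℝ) (n := m)) 0
  rw [fwdDiff_iter_eq_sum_shift] at h
  have hm : (m.factorial : ℝ) ≠ 0 := by exact_mod_cast Nat.factorial_ne_zero m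
  have key : ∀ k ∈ Finset.range (m + 1),
      ((-1 : ℝ) ^ k * k ^ k / k.factorial) * ((k : ℝ) ^ (m - k) / (m - k).factorial)
        = (-1) ^ m / m.factorial *
          (((-1 : ℤ) ^ (m - k) * m.choose k) • ((0 : ℝ) + k • (1 : ℝ)) ^ m) := by
    intro k hk
    have hkm : k ≤ m := Nat.lt_succ_iff.1 (Finset.mem_range.1 hk)
    obtain ⟨j, rfl⟩ := Nat.exists_eq_add_of_le hkm
    have hk' : (k.factorial : ℝ) ≠ 0 := by exact_mod_cast Nat.factorial_ne_zero k
    have hj' : (j.factorial : ℝ) ≠ 0 := by exact_mod_cast Nat.factorial_ne_zero j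
    have hs : ((-1 : ℝ) ^ j) * (-1) ^ j = 1 := by
      rw [← mul_pow]
      norm_num
    rw [Nat.add_sub_cancel_left, Nat.choose_symm_add, Nat.add_choose, zsmul_eq_mul, Int.cast_mul,
      Int.cast_natCast, Nat.cast_div (Nat.factorial_mul_factorial_dvd_factorial_add k j)
      (by push_cast; positivity)]
    push_cast
    rw [nsmul_one, zero_add, pow_add (-1 : ℝ), pow_add (k : ℝ)]
    field_simp
    linear_combination (-(k : ℝ) ^ j) * hs
  rw [Finset.Nat.sum_antidiagonal_eq_sum_range_succ_mk, Finset.sum_congr rfl key,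
    ← Finset.mul_sum, h]
  simp [hm]

theorem natCast_pow_self_div_factorial_le (n : ℕ) :
    (n : ℝ) ^ n / n.factorial ≤ Real.exp 1 ^ n := by
  rw [← Real.exp_nat_mul, mul_one]
  exact Real.pow_div_factorial_le_exp (n : ℝ) (Nat.cast_nonneg n) n

/-- Expansion of `1 / (1 + w)` in powers of `w * exp w`. -/
theorem hasSum_one_div_one_add {w : ℝ} (hw : 0 ≤ w) (h : w * Real.exp w * Real.exp 1 < 1) :
    HasSum (fun n : ℕ => (-(w * Real.exp w)) ^ n * ((n : ℝ) ^ n / n.factorial)) (1 / (1 + w)) := by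
  -- Expanding `exp (n w)` gives a double series: its rows sum to the stated terms, its
  -- antidiagonals to `(-w)^m`. Since `n^n / n! ≤ e^n`, the hypothesis makes it absolutely summable.
  set f : ℕ × ℕ → ℝ := fun p =>
    ((-1) ^ p.1 * p.1 ^ p.1 / p.1.factorial * w ^ p.1) * ((p.1 * w) ^ p.2 / p.2.factorial) with hf
  have hexp : ∀ x : ℝ, HasSum (fun k : ℕ => x ^ k / k.factorial) (Real.exp x) := fun x => by
    rw [Real.exp_eq_exp_ℝ]
    exact NormedSpace.expSeries_div_hasSum_exp x
  have hnorm : ∀ p, ‖f p‖ = (p.1 ^ p.1 / p.1.factorial * w ^ p.1) *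
      ((p.1 * w) ^ p.2 / p.2.factorial) := fun p => by
    simp only [hf, norm_mul, norm_div, norm_pow, norm_neg, norm_one, one_pow, one_mul,
      RCLike.norm_natCast, Real.norm_of_nonneg hw]
  have hrow : ∀ n : ℕ, HasSum (fun k => f (n, k))
      ((-(w * Real.exp w)) ^ n * ((n : ℝ) ^ n / n.factorial)) := fun n => by
    have h1 := (hexp (n * w)).mul_left ((-1) ^ n * n ^ n / n.factorial * w ^ n)
    have h2 : (-(w * Real.exp w)) ^ n * ((n : ℝ) ^ n / n.factorial)
        = (-1) ^ n * n ^ n / n.factorial * w ^ n * Real.exp (n * w) := by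
      rw [Real.exp_nat_mul, neg_pow, mul_pow]
      ring
    rwa [h2]
  have hlt : ‖w * Real.exp w * Real.exp 1‖ < 1 := by
    rwa [Real.norm_of_nonneg (by positivity)]
  have hsum : Summable f := by
    refine Summable.of_norm ?_
    rw [summable_prod_of_nonneg fun _ => norm_nonneg _]
    refine ⟨fun n => ?_, ?_⟩
    · simp_rw [hnorm]
      exact (hexp (n * w)).summable.mul_left _
    · refine Summable.of_nonneg_of_le (fun n => tsum_nonneg fun _ => norm_nonneg _) (fun n => ?_)
        (summable_geometric_of_norm_lt_one hlt)
      simp_rw [hnorm]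
      rw [tsum_mul_left, (hexp (n * w)).tsum_eq, Real.exp_nat_mul, mul_pow, mul_pow]
      have := natCast_pow_self_div_factorial_le n
      calc _ = ((n : ℝ) ^ n / n.factorial) * (w ^ n * Real.exp w ^ n) := by ring
        _ ≤ Real.exp 1 ^ n * (w ^ n * Real.exp w ^ n) := by gcongr
        _ = _ := by ring
  have hw1 : w < 1 := by
    have h1 : 1 ≤ Real.exp w := Real.one_le_exp hw
    have h2 : 1 ≤ Real.exp 1 := Real.one_le_exp zero_le_one
    nlinarith [mul_nonneg hw (sub_nonneg.2 h1), mul_nonneg (mul_nonneg hw (Real.exp_pos w).le)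
      (sub_nonneg.2 h2)]
  have hgeo : HasSum (fun m : ℕ => (-w) ^ m) (1 / (1 + w)) := by
    have := hasSum_geometric_of_norm_lt_one (ξ := -w) (by
      rwa [norm_neg, Real.norm_of_nonneg hw])
    simpa using this
  have hdiag : ∀ m : ℕ, HasSum (fun p : Finset.HasAntidiagonal.antidiagonal m => f p) ((-w) ^ m) := fun m => by
    have h1 := hasSum_fintype (fun p : Finset.HasAntidiagonal.antidiagonal m => f p)
    rw [Finset.sum_coe_sort (Finset.HasAntidiagonal.antidiagonal m) f] at h1
    convert h1 using 1
    rw [neg_pow, ← sum_antidiagonal_neg_one_pow_mul_pow, Finset.sum_mul]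
    refine Finset.sum_congr rfl fun p hp => ?_
    rw [← Finset.HasAntidiagonal.mem_antidiagonal.1 hp]
    simp only [hf]
    rw [pow_add, mul_pow]
    ring
  have hs2 := (Finset.HasAntidiagonal.sigmaAntidiagonalEquivProd (A := ℕ)).hasSum_iff.2 hsum.hasSum
  have htot : ∑' p, f p = 1 / (1 + w) := (hs2.sigma hdiag).unique hgeo
  rw [← htot]
  exact hsum.hasSum.prod_fiberwise hrow

theorem hasSum_integral_one_div {x : ℝ} (hx0 : 0 ≤ x) (hx : x * Real.exp 1 < 1) :
    HasSum (fun n : ℕ => (-x) ^ n * ((n : ℝ) ^ n / n.factorial))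
      (1 / Real.pi * ∫ v in (0 : ℝ)..Real.pi, 1 / (1 + x * lambertDensity v)) := by
  have hq := measurable_lambertDensity
  have hnn : 0 ≤ x * Real.exp 1 := by positivity
  have hgeo : Summable fun n : ℕ => (x * Real.exp 1) ^ n :=
    summable_geometric_of_lt_one hnn hx
  have hb : ∀ v ∈ uIoc 0 Real.pi, ‖-(x * lambertDensity v)‖ ≤ x * Real.exp 1 := fun v hv => by
    rw [uIoc_of_le Real.pi_pos.le] at hv
    have hm := lambertDensity_mem_Icc hv
    rw [norm_neg, Real.norm_of_nonneg (mul_nonneg hx0 hm.1)]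
    exact mul_le_mul_of_nonneg_left hm.2 hx0
  have := intervalIntegral.hasSum_integral_of_dominated_convergence
    (μ := MeasureTheory.volume) (a := 0) (b := Real.pi)
    (F := fun (n : ℕ) v => (-(x * lambertDensity v)) ^ n)
    (f := fun v => 1 / (1 + x * lambertDensity v))
    (fun n _ => (x * Real.exp 1) ^ n)
    (fun n => (by fun_prop : Measurable _).aestronglyMeasurable)
    (fun n => Eventually.of_forall fun v hv => by
      rw [norm_pow]
      exact pow_le_pow_left₀ (norm_nonneg _) (hb v hv) n)
    (Eventually.of_forall fun v hv => hgeo) intervalIntegrable_const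
    (Eventually.of_forall fun v hv => by
      have := hasSum_geometric_of_norm_lt_one ((hb v hv).trans_lt hx)
      simpa using this)
  have hterm : ∀ n : ℕ, 1 / Real.pi * ∫ v in (0 : ℝ)..Real.pi, (-(x * lambertDensity v)) ^ n
      = (-x) ^ n * ((n : ℝ) ^ n / n.factorial) := fun n => by
    simp_rw [← neg_mul, mul_pow]
    rw [intervalIntegral.integral_const_mul, integral_lambertDensity_pow]
    field_simp
  simpa only [hterm] using this.mul_left (1 / Real.pi)

theorem integral_one_div_mul_exp {w : ℝ} (hw : 0 ≤ w) (h : w * Real.exp w * Real.exp 1 < 1) :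
    1 / Real.pi * ∫ v in (0 : ℝ)..Real.pi, 1 / (1 + w * Real.exp w * lambertDensity v)
      = 1 / (1 + w) :=
  (hasSum_integral_one_div (mul_nonneg hw (Real.exp_pos w).le) h).unique
    (hasSum_one_div_one_add hw h)

/-! ### Identification of the principal branch -/

theorem lambertStieltjes_one_ofReal (x : ℝ) : lambertStieltjes (fun _ => 1) x
    = ((1 / Real.pi * ∫ v in (0 : ℝ)..Real.pi, 1 / (1 + x * lambertDensity v) : ℝ) : ℂ) := by
  rw [lambertStieltjes, ofReal_mul, ← intervalIntegral.integral_ofReal]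
  push_cast
  rfl

theorem neg_exp_inv_lt_of_ofReal_mem {x : ℝ} (hx : (x : ℂ) ∈ lambertCutᶜ) :
    -(1 / Real.exp 1) < x := by
  by_contra h
  exact hx ⟨x, not_lt.1 h, rfl⟩

theorem one_add_mul_pos {x : ℝ} (hx : (x : ℂ) ∈ lambertCutᶜ) {t : ℝ}
    (ht : t ∈ Icc 0 (Real.exp 1)) : 0 < 1 + x * t := by
  have h := neg_exp_inv_lt_of_ofReal_mem hx
  have he := Real.exp_pos 1
  rcases le_or_gt 0 x with h0 | h0
  · nlinarith [mul_nonneg h0 ht.1]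
  · have h1 : -1 < x * Real.exp 1 := by
      have := mul_lt_mul_of_pos_right h he
      rwa [neg_mul, one_div, inv_mul_cancel₀ he.ne'] at this
    nlinarith [ht.2]

theorem intervalIntegrable_one_div_real {x : ℝ} (hx : (x : ℂ) ∈ lambertCutᶜ) :
    IntervalIntegrable (fun v => 1 / (1 + x * lambertDensity v))
      MeasureTheory.volume 0 Real.pi := by
  have h := intervalIntegrable_weight_div (R := fun _ => 1) measurable_const (C := 1)
    (by simp) hx 1
  rw [intervalIntegrable_iff] at h ⊢
  have h2 := h.re
  refine h2.congr (Eventually.of_forall fun v => ?_)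
  have : ((1 : ℝ) : ℂ) / (1 + (x : ℂ) * lambertDensity v) ^ 1
      = ((1 / (1 + x * lambertDensity v) : ℝ) : ℂ) := by
    push_cast
    rw [pow_one]
  simp only [this]
  exact ofReal_re _

theorem integral_one_div_pos {x : ℝ} (hx : (x : ℂ) ∈ lambertCutᶜ) :
    0 < 1 / Real.pi * ∫ v in (0 : ℝ)..Real.pi, 1 / (1 + x * lambertDensity v) := by
  refine mul_pos (by positivity) (intervalIntegral.intervalIntegral_pos_of_pos_on
    (intervalIntegrable_one_div_real hx) (fun v hv => ?_) Real.pi_pos)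
  have := one_add_mul_pos hx (lambertDensity_mem_Icc ⟨hv.1, hv.2.le⟩)
  positivity

theorem integral_one_div_lt_one {x : ℝ} (hx : 0 < x) :
    1 / Real.pi * ∫ v in (0 : ℝ)..Real.pi, 1 / (1 + x * lambertDensity v) < 1 := by
  have hx' := ofReal_notMem_lambertCut hx
  have hi := intervalIntegrable_one_div_real hx'
  have h : 0 < ∫ v in (0 : ℝ)..Real.pi, (1 - 1 / (1 + x * lambertDensity v)) := by
    refine intervalIntegral.intervalIntegral_pos_of_pos_on (intervalIntegrable_const.sub hi)
      (fun v hv => ?_) Real.pi_pos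
    have h1 := mul_pos hx (lambertDensity_pos hv)
    rw [sub_pos, div_lt_one (by positivity)]
    linarith
  rw [intervalIntegral.integral_sub intervalIntegrable_const hi] at h
  simp only [intervalIntegral.integral_const, sub_zero, smul_eq_mul, mul_one] at h
  rw [one_div, inv_mul_lt_one₀ Real.pi_pos]
  linarith

theorem lambertStieltjes_one_ne_zero {z : ℂ} (hz : z ∈ lambertCutᶜ) :
    lambertStieltjes (fun _ => 1) z ≠ 0 := by
  by_cases him : z.im = 0
  · obtain ⟨x, rfl⟩ : ∃ x : ℝ, z = x := ⟨z.re, Complex.ext rfl (by simpa using him)⟩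
    rw [lambertStieltjes_one_ofReal]
    exact_mod_cast (integral_one_div_pos hz).ne'
  · have hi := intervalIntegrable_weight_div (R := fun _ => 1) measurable_const (C := 1)
      (by simp) hz 1
    simp only [pow_one] at hi
    refine mul_ne_zero (by simp [Real.pi_ne_zero]) fun h0 => ?_
    -- The functional `-Im / Im z` sends the integrand to `q / |1 + z q|^2 > 0`, so the integral
    -- cannot vanish.
    have hcomm := ((-(1 / z.im)) • Complex.imCLM).intervalIntegral_comp_comm hi
    rw [h0, map_zero] at hcomm
    refine (intervalIntegral.intervalIntegral_pos_of_pos_on ?_ (fun v hv => ?_)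
      Real.pi_pos).ne' hcomm
    · rw [intervalIntegrable_iff] at hi ⊢
      exact ((-(1 / z.im)) • Complex.imCLM).integrable_comp hi
    · have hq := lambertDensity_pos hv
      have hne := one_add_mul_ne_zero hz (lambertDensity_mem_Icc ⟨hv.1, hv.2.le⟩)
      have hns := normSq_pos.2 hne
      have : ((-(1 / z.im)) • Complex.imCLM) (((1 : ℝ) : ℂ) / (1 + z * lambertDensity v))
          = lambertDensity v / normSq (1 + z * lambertDensity v) := by
        simp only [smul_apply, imCLM_apply, smul_eq_mul, ofReal_one, one_div,
          inv_im, add_im, one_im, im_mul_ofReal, zero_add]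
        field_simp
      rw [this]
      positivity

/-- The principal branch of the Lambert function off the cut, as a Stieltjes-type integral. -/
noncomputable def stieltjesLambert (z : ℂ) : ℂ := 1 / lambertStieltjes (fun _ => 1) z - 1

theorem differentiableAt_lambertStieltjes_one {z : ℂ} (hz : z ∈ lambertCutᶜ) :
    DifferentiableAt ℂ (lambertStieltjes fun _ => 1) z :=
  (hasDerivAt_lambertStieltjes (R := fun _ => 1) measurable_const (C := 1)
    (by simp) hz).differentiableAt

theorem differentiableOn_stieltjesLambert : DifferentiableOn ℂ stieltjesLambert lambertCutᶜ :=
  fun _ hz => (((differentiableAt_const 1).div (differentiableAt_lambertStieltjes_one hz)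
    (lambertStieltjes_one_ne_zero hz)).sub_const 1).differentiableWithinAt

theorem zero_notMem_lambertCut : (0 : ℂ) ∈ lambertCutᶜ := by
  rintro ⟨t, ht, h⟩
  have ht0 : t = 0 := by exact_mod_cast h
  have : (0 : ℝ) < 1 / Real.exp 1 := by positivity
  simp only [Set.mem_Iic] at ht
  linarith

theorem stieltjesLambert_mul_exp {z : ℂ} (hz : z ∈ lambertCutᶜ) :
    stieltjesLambert z * exp (stieltjesLambert z) = z := by
  have ho : IsOpen lambertCutᶜ := lambertCut_isClosed.isOpen_compl
  have hd := differentiableOn_stieltjesLambert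
  refine ((hd.mul hd.cexp).analyticOnNhd ho).eqOn_of_preconnected_of_frequently_eq
    (differentiableOn_id.analyticOnNhd ho) lambertCut_compl_isPreconnected
    zero_notMem_lambertCut ?_ hz
  have hc : Continuous fun w : ℝ => ((w * Real.exp w : ℝ) : ℂ) := by fun_prop
  -- The points `w exp w` with `w → 0+` accumulate at `0`, and there the candidate takes the value
  -- `w`.
  have ht : Tendsto (fun w : ℝ => ((w * Real.exp w : ℝ) : ℂ)) (𝓝[>] 0) (𝓝[≠] 0) := by
    refine tendsto_nhdsWithin_iff.2 ⟨?_, ?_⟩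
    · simpa using (hc.tendsto 0).mono_left nhdsWithin_le_nhds
    · filter_upwards [self_mem_nhdsWithin] with w hw h
      have h' : w * Real.exp w = 0 := ofReal_eq_zero.1 h
      exact (mul_pos hw (Real.exp_pos w)).ne' h'
  refine ht.frequently (Eventually.frequently ?_)
  have hsmall : ∀ᶠ w : ℝ in 𝓝[>] 0, w * Real.exp w * Real.exp 1 < 1 := by
    have hc' : Continuous fun w : ℝ => w * Real.exp w * Real.exp 1 := by fun_prop
    have := (hc'.tendsto 0).mono_left (nhdsWithin_le_nhds (s := Ioi 0))
    simp only [zero_mul] at this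
    exact this.eventually_lt_const one_pos
  filter_upwards [self_mem_nhdsWithin, hsmall] with w hw hs
  have hw0 : 0 < w := hw
  have : stieltjesLambert ((w * Real.exp w : ℝ) : ℂ) = w := by
    rw [stieltjesLambert, lambertStieltjes_one_ofReal, integral_one_div_mul_exp hw0.le hs]
    push_cast
    rw [one_div_one_div, add_sub_cancel_left]
  simp only [Pi.mul_apply, this, id]
  push_cast
  rfl

theorem mul_exp_injOn : InjOn (fun y : ℝ => y * Real.exp y) (Ioi 0) := by
  refine StrictMonoOn.injOn fun x hx y _ hxy => ?_
  exact mul_lt_mul'' hxy (Real.exp_lt_exp.2 hxy) (le_of_lt hx) (Real.exp_pos x).le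

theorem isPrincipalLambert_stieltjesLambert : IsPrincipalLambert stieltjesLambert where
  differentiableOn := differentiableOn_stieltjesLambert
  mul_exp _ hz := stieltjesLambert_mul_exp hz
  image_pos := by
    have key : ∀ x : ℝ, 0 < x → ∃ y : ℝ, 0 < y ∧ stieltjesLambert x = y ∧ y * Real.exp y = x := by
      intro x hx
      have hx' := ofReal_notMem_lambertCut hx
      have h1 := integral_one_div_pos hx'
      have h2 := integral_one_div_lt_one hx
      set g := 1 / Real.pi * ∫ v in (0 : ℝ)..Real.pi, 1 / (1 + x * lambertDensity v) with hg
      have hW : stieltjesLambert x = ((1 / g - 1 : ℝ) : ℂ) := by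
        rw [stieltjesLambert, lambertStieltjes_one_ofReal, ← hg]
        push_cast
        rfl
      refine ⟨1 / g - 1, sub_pos.2 ((one_lt_div h1).2 h2), hW, ?_⟩
      have := stieltjesLambert_mul_exp hx'
      rw [hW] at this
      exact_mod_cast this
    ext u
    constructor
    · rintro ⟨_, ⟨x, hx, rfl⟩, rfl⟩
      obtain ⟨y, hy, hWy, -⟩ := key x hx
      exact ⟨y, hy, hWy.symm⟩
    · rintro ⟨y, hy, rfl⟩
      have hx : 0 < y * Real.exp y := mul_pos hy (Real.exp_pos y)
      obtain ⟨y', hy', hWy, e⟩ := key _ hx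
      refine ⟨_, ⟨_, hx, rfl⟩, ?_⟩
      -- Surjectivity: the value at `y exp y` must be `y` by injectivity.
      rw [hWy, mul_exp_injOn hy' hy e]

theorem lambertW_eq_stieltjesLambert {z : ℂ} (hz : z ∈ lambertCutᶜ) :
    lambertW z = stieltjesLambert z := by
  rw [lambertW, if_neg hz]
  exact (Classical.epsilon_spec ⟨_, isPrincipalLambert_stieltjesLambert⟩ :
    IsPrincipalLambert lambertWOffCut).eqOn isPrincipalLambert_stieltjesLambert hz

/-! ### The exponential of the branch -/

/-- The weight `|1 + 1 / γ| ^ 2` along the boundary curve `γ`. -/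
noncomputable def lambertWeight (v : ℝ) : ℝ :=
  Real.sin v ^ 2 + (Real.sin v / v - Real.cos v) ^ 2

theorem measurable_lambertWeight : Measurable lambertWeight := by
  unfold lambertWeight
  fun_prop

theorem abs_sin_div_self_le_one (v : ℝ) : |Real.sin v / v| ≤ 1 := by
  rw [abs_div]
  exact div_le_one_of_le₀ Real.abs_sin_le_abs (abs_nonneg v)

theorem abs_lambertWeight_le (v : ℝ) : |lambertWeight v| ≤ 5 := by
  have h1 := abs_le.1 (abs_sin_div_self_le_one v)
  have h2 := Real.neg_one_le_cos v
  have h3 := Real.cos_le_one v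
  have h4 := Real.sin_sq_le_one v
  rw [lambertWeight, abs_of_nonneg (by positivity)]
  nlinarith

theorem hasDerivAt_sin_sq_div {v : ℝ} (hv : v ≠ 0) :
    HasDerivAt (fun v => -(Real.sin v ^ 2 / v)) (lambertWeight v - 1) v := by
  refine (((Real.hasDerivAt_sin v).pow 2).div (hasDerivAt_id' v) hv).neg.congr_deriv ?_
  simp only [lambertWeight, Pi.pow_apply]
  field_simp
  push_cast
  linear_combination (-v ^ 2) * Real.sin_sq_add_cos_sq v

/-- With `B = -sin² v / v`, one has `B' = R - 1` and `B q' / q = R`, so `B / (1 + z q)` is a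
primitive of the difference of the integrands. It vanishes at both ends. -/
theorem integral_weight_div_sq {z : ℂ} (hz : z ∈ lambertCutᶜ) :
    ∫ v in (0 : ℝ)..Real.pi, (lambertWeight v : ℂ) / (1 + z * lambertDensity v) ^ 2
      = ∫ v in (0 : ℝ)..Real.pi, ((1 : ℝ) : ℂ) / (1 + z * lambertDensity v) := by
  have hi2 := intervalIntegrable_weight_div measurable_lambertWeight abs_lambertWeight_le hz 2
  have hi1 := intervalIntegrable_weight_div (R := fun _ => 1) measurable_const (C := 1)
    (by simp) hz 1
  simp only [pow_one] at hi1
  obtain ⟨δ, hδ, c, hc, hbd⟩ := exists_norm_one_add_mul_ge hz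
  have hder : ∀ v ∈ Ioo 0 Real.pi, HasDerivAt
      (fun v : ℝ => ((-(Real.sin v ^ 2 / v) : ℝ) : ℂ) / (1 + z * lambertDensity v))
      ((lambertWeight v : ℂ) / (1 + z * lambertDensity v) ^ 2
        - ((1 : ℝ) : ℂ) / (1 + z * lambertDensity v)) v := fun v hv => by
    have hne := one_add_mul_ne_zero hz (lambertDensity_mem_Icc ⟨hv.1, hv.2.le⟩)
    have hs := (Real.sin_pos_of_mem_Ioo hv).ne'
    have hv0 := hv.1.ne'
    have hB := (hasDerivAt_sin_sq_div hv0).ofReal_comp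
    have hq := ((hasDerivAt_lambertDensity hv).ofReal_comp.const_mul z).const_add 1
    refine (hB.div hq hne).congr_deriv ?_
    have hw : (2 * Real.cot v - v / Real.sin v ^ 2 - 1 / v) * (-(Real.sin v ^ 2 / v))
        = lambertWeight v := by
      rw [Real.cot_eq_cos_div_sin, lambertWeight]
      field_simp
      linear_combination (-v ^ 2) * Real.sin_sq_add_cos_sq v
    have hw' : (((2 * Real.cot v - v / Real.sin v ^ 2 - 1 / v : ℝ) : ℂ))
        * ((-(Real.sin v ^ 2 / v) : ℝ) : ℂ) = lambertWeight v := by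
      rw [← hw, ofReal_mul]
    rw [ofReal_sub, ofReal_mul (lambertDensity v), ofReal_one]
    generalize ((2 * Real.cot v - v / Real.sin v ^ 2 - 1 / v : ℝ) : ℂ) = r at hw' ⊢
    field_simp
    linear_combination (-z * (lambertDensity v : ℂ)) * hw'
  have hlim : ∀ (l : Filter ℝ), Tendsto Real.sin l (𝓝 0) → (∀ᶠ v in l, v ∈ Ioo 0 Real.pi) →
      Tendsto (fun v : ℝ => ((-(Real.sin v ^ 2 / v) : ℝ) : ℂ) / (1 + z * lambertDensity v)) l
        (𝓝 0) := fun l hl hmem => by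
    refine squeeze_zero_norm' (a := fun v => |Real.sin v| / c) ?_ (by
      simpa using hl.abs.div_const c)
    filter_upwards [hmem] with v hv
    have h1 := hbd z (Metric.mem_ball_self hδ) _ (lambertDensity_mem_Icc ⟨hv.1, hv.2.le⟩)
    rw [norm_div, norm_real, norm_neg, Real.norm_eq_abs]
    have h2 : |Real.sin v ^ 2 / v| ≤ |Real.sin v| := by
      rw [pow_two, mul_div_assoc, abs_mul]
      exact mul_le_of_le_one_right (abs_nonneg _) (abs_sin_div_self_le_one v)
    gcongr
  have key := intervalIntegral.integral_eq_sub_of_hasDerivAt_of_tendsto Real.pi_pos hder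
    (hi2.sub hi1)
    (hlim _ (by simpa using (Real.continuous_sin.tendsto 0).mono_left nhdsWithin_le_nhds)
      (Ioo_mem_nhdsGT Real.pi_pos))
    (hlim _ (by simpa using (Real.continuous_sin.tendsto Real.pi).mono_left nhdsWithin_le_nhds)
      (Ioo_mem_nhdsLT Real.pi_pos))
  rw [intervalIntegral.integral_sub hi2 hi1, sub_zero] at key
  exact sub_eq_zero.1 key

theorem hasDerivAt_mul_lambertStieltjes_weight {z : ℂ} (hz : z ∈ lambertCutᶜ) :
    HasDerivAt (fun z => 1 + z * lambertStieltjes lambertWeight z)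
      (lambertStieltjes (fun _ => 1) z) z := by
  have hd := hasDerivAt_lambertStieltjes measurable_lambertWeight abs_lambertWeight_le hz
  refine (((hasDerivAt_id' z).mul hd).const_add 1).congr_deriv ?_
  have hi1 := intervalIntegrable_weight_div measurable_lambertWeight abs_lambertWeight_le hz 1
  have hi2 := intervalIntegrable_weight_div measurable_lambertWeight abs_lambertWeight_le hz 2
  simp only [pow_one] at hi1
  have hsplit : EqOn (fun v => -((lambertWeight v : ℂ) * lambertDensity v)
        / (1 + z * lambertDensity v) ^ 2 * z)
      (fun v => (lambertWeight v : ℂ) / (1 + z * lambertDensity v) ^ 2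
        - (lambertWeight v : ℂ) / (1 + z * lambertDensity v)) (uIoo 0 Real.pi) := fun v hv => by
    rw [uIoo_of_le Real.pi_pos.le] at hv
    have hne := one_add_mul_ne_zero hz (lambertDensity_mem_Icc ⟨hv.1, hv.2.le⟩)
    field_simp
    ring
  have hz' : (∫ v in (0 : ℝ)..Real.pi, -((lambertWeight v : ℂ) * lambertDensity v)
        / (1 + z * lambertDensity v) ^ 2) * z
      = (∫ v in (0 : ℝ)..Real.pi, ((1 : ℝ) : ℂ) / (1 + z * lambertDensity v))
        - ∫ v in (0 : ℝ)..Real.pi, (lambertWeight v : ℂ) / (1 + z * lambertDensity v) := by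
    rw [← intervalIntegral.integral_mul_const, intervalIntegral.integral_congr_uIoo hsplit,
      intervalIntegral.integral_sub hi2 hi1, integral_weight_div_sq hz]
  simp only [lambertStieltjes]
  linear_combination (1 / (Real.pi : ℂ)) * hz'

theorem one_add_stieltjesLambert {z : ℂ} (hz : z ∈ lambertCutᶜ) :
    (1 + stieltjesLambert z) * lambertStieltjes (fun _ => 1) z = 1 := by
  have := lambertStieltjes_one_ne_zero hz
  rw [stieltjesLambert]
  field_simp
  ring

/-- Differentiating `W exp W = z` gives `(1 + W) W' exp W = 1`. -/
theorem hasDerivAt_exp_stieltjesLambert {z : ℂ} (hz : z ∈ lambertCutᶜ) :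
    HasDerivAt (fun z => exp (stieltjesLambert z)) (lambertStieltjes (fun _ => 1) z) z := by
  have hnhds := lambertCut_isClosed.isOpen_compl.mem_nhds hz
  have hW := (differentiableOn_stieltjesLambert.differentiableAt hnhds).hasDerivAt
  have h1 := hW.mul hW.cexp
  have h2 : HasDerivAt (fun z => stieltjesLambert z * exp (stieltjesLambert z)) 1 z :=
    (hasDerivAt_id z).congr_of_eventuallyEq (by
      filter_upwards [hnhds] with w hw
      exact stieltjesLambert_mul_exp hw)
  have h3 := h1.unique h2
  have h4 := one_add_stieltjesLambert hz
  refine hW.cexp.congr_deriv ?_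
  linear_combination (lambertStieltjes (fun _ => 1) z) * h3 -
    (exp (stieltjesLambert z) * deriv stieltjesLambert z) * h4

theorem exp_stieltjesLambert {z : ℂ} (hz : z ∈ lambertCutᶜ) :
    exp (stieltjesLambert z) = 1 + z * lambertStieltjes lambertWeight z := by
  have h0 : stieltjesLambert 0 = 0 := by
    have := stieltjesLambert_mul_exp zero_notMem_lambertCut
    exact (mul_eq_zero.1 this).resolve_right (exp_ne_zero _)
  refine lambertCut_isClosed.isOpen_compl.eqOn_of_deriv_eq lambertCut_compl_isPreconnected
    (f := fun z => exp (stieltjesLambert z))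
    (fun w hw => (hasDerivAt_exp_stieltjesLambert hw).differentiableAt.differentiableWithinAt)
    (fun w hw =>
      (hasDerivAt_mul_lambertStieltjes_weight hw).differentiableAt.differentiableWithinAt)
    (fun w hw => ?_) zero_notMem_lambertCut ?_ hz
  · rw [(hasDerivAt_exp_stieltjesLambert hw).deriv,
      (hasDerivAt_mul_lambertStieltjes_weight hw).deriv]
  · simp [h0]

/-! ### The two integral formulas -/

theorem notMem_lambertCut_of_abs_arg_lt {z : ℂ} (harg : |z.arg| < Real.pi) :
    z ∈ lambertCutᶜ := by
  rintro ⟨t, ht, rfl⟩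
  have h0 : t < 0 := lt_of_le_of_lt ht (neg_lt_zero.2 (by positivity))
  rw [arg_ofReal_of_neg h0, abs_of_pos Real.pi_pos] at harg
  exact harg.false

theorem mainTheorem7 (z : ℂ) (hz : z ≠ 0) (harg : |z.arg| < Real.pi) :
    (IntervalIntegrable
        (fun v : ℝ => 1 / (1 + z * (Real.exp (v * Real.cot v) : ℂ) * (Real.sin v : ℂ) / (v : ℂ)))
        MeasureTheory.volume 0 Real.pi ∧
      1 / (1 + lambertW z) =
        (1 / (Real.pi : ℂ)) * ∫ v in (0 : ℝ)..Real.pi,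
          1 / (1 + z * (Real.exp (v * Real.cot v) : ℂ) * (Real.sin v : ℂ) / (v : ℂ))) ∧
    (IntervalIntegrable
        (fun v : ℝ => ((v ^ 2 + (1 - v * Real.cot v) ^ 2 : ℝ) : ℂ) /
          (((v * csc v : ℝ) : ℂ) *
            (((v * csc v : ℝ) : ℂ) + z * (Real.exp (v * Real.cot v) : ℂ))))
        MeasureTheory.volume 0 Real.pi ∧
      1 / lambertW z =
        1 / z + (1 / (Real.pi : ℂ)) * ∫ v in (0 : ℝ)..Real.pi,
          ((v ^ 2 + (1 - v * Real.cot v) ^ 2 : ℝ) : ℂ) /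
            (((v * csc v : ℝ) : ℂ) *
              (((v * csc v : ℝ) : ℂ) + z * (Real.exp (v * Real.cot v) : ℂ)))) := by
  have hzc := notMem_lambertCut_of_abs_arg_lt harg
  have hW := lambertW_eq_stieltjesLambert hzc
  have hf : (fun v : ℝ =>
      1 / (1 + z * (Real.exp (v * Real.cot v) : ℂ) * (Real.sin v : ℂ) / (v : ℂ)))
      = fun v : ℝ => ((1 : ℝ) : ℂ) / (1 + z * lambertDensity v) := by
    ext v
    rw [lambertDensity, ofReal_div, ofReal_mul, ofReal_one, mul_assoc, mul_div_assoc]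
  -- Cancel `(v csc v)²`. This is legitimate only on the open interval, as `csc` takes the junk
  -- value of `1 / 0` at `0`.
  have hg : EqOn (fun v : ℝ => ((v ^ 2 + (1 - v * Real.cot v) ^ 2 : ℝ) : ℂ) /
        (((v * csc v : ℝ) : ℂ) *
          (((v * csc v : ℝ) : ℂ) + z * (Real.exp (v * Real.cot v) : ℂ))))
      (fun v => (lambertWeight v : ℂ) / (1 + z * lambertDensity v)) (uIoo 0 Real.pi) := by
    intro v hv
    rw [uIoo_of_le Real.pi_pos.le] at hv
    have hne := one_add_mul_ne_zero hzc (lambertDensity_mem_Icc ⟨hv.1, hv.2.le⟩)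
    have hs := (Real.sin_pos_of_mem_Ioo hv).ne'
    have hv0 := hv.1.ne'
    have hw : v ^ 2 + (1 - v * Real.cot v) ^ 2 = lambertWeight v * (v * csc v) ^ 2 := by
      rw [csc, lambertWeight, Real.cot_eq_cos_div_sin]
      field_simp
    have he : Real.exp (v * Real.cot v) = lambertDensity v * (v * csc v) := by
      rw [csc, lambertDensity]
      field_simp
    have hc : ((v * csc v : ℝ) : ℂ) ≠ 0 := by
      rw [csc]
      exact_mod_cast mul_ne_zero hv0 (one_div_ne_zero hs)
    beta_reduce
    rw [hw, he, ofReal_mul (lambertWeight v), ofReal_pow, ofReal_mul (lambertDensity v)]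
    generalize ((v * csc v : ℝ) : ℂ) = c at hc
    have hfac : c * (c + z * (lambertDensity v * c)) = (1 + z * lambertDensity v) * c ^ 2 := by ring
    rw [hfac, mul_div_mul_right _ _ (pow_ne_zero 2 hc)]
  have hi1 := intervalIntegrable_weight_div (R := fun _ => 1) measurable_const (C := 1)
    (by simp) hzc 1
  have hi2 := intervalIntegrable_weight_div measurable_lambertWeight abs_lambertWeight_le hzc 1
  simp only [pow_one] at hi1 hi2
  refine ⟨⟨hf ▸ hi1, ?_⟩, hi2.congr_uIoo hg.symm, ?_⟩
  · rw [hf, hW]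
    exact (eq_one_div_of_mul_eq_one_right (one_add_stieltjesLambert hzc)).symm
  · rw [intervalIntegral.integral_congr_uIoo hg, hW]
    have h1 := stieltjesLambert_mul_exp hzc
    have hW0 : stieltjesLambert z ≠ 0 := by
      intro h
      rw [h, zero_mul] at h1
      exact hz h1.symm
    -- Now `W (1 + z S_R) = z`, which is the claim after division by `z W`.
    rw [exp_stieltjesLambert hzc] at h1
    change _ = 1 / z + lambertStieltjes lambertWeight z
    field_simp
    linear_combination -h1
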